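/- Let $M=(\mathcal X,\mathcal A,P,r,H)$ be an episodic Markov decision process with countable state space $\mathcal X$ and countable action space $\mathcal A$, horizon $H\in\mathbb N$, initial state law $P_0$, transition laws $P_h(\cdot\mid x,a)$ on $\mathcal X$ and rewards $r_h:\mathcal X\times\mathcal A\to\mathbb R$ ($1\le h\le H$). A (possibly stochastic) policy is a sequence $\pi=(\pi_h)_{h=1}^H$ of maps from $\mathcal X$ to probability distributions on $\mathcal A$. Let $\mathbb P^\pi$ and $\mathbb E^\pi$ denote the law of, and the expectation over, the trajectory $(x_1,a_1),\dots,(x_H,a_H)$ with $x_1\sim P_0$, $a_h\sim\pi_h(x_h)$, $x_{h+1}\sim P_h(x_h,a_h)$; write $r_h=r_h(x_h,a_h)$ along the trajectory, and set $J(\pi)=\mathbb E^\pi[\sum_{h=1}^H r_h]$ and $Q_h^\pi(x,a)=\mathbb E^\pi[\sum_{k=h}^H r_k\mid x_h=x,a_h=a]$ (the expectation for the process started from $(x,a)$ at step $h$). Put $Q_h^\pi(x,\pi_h(x))=\mathbb E_{a\sim\pi_h(x)}[Q_h^\pi(x,a)]$ and $$\sigma_\pi^2=\sum_{h=1}^H\mathbb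 E^\pi\Big[\big(Q_h^\pi(x_h,\pi_h(x_h))-Q_h^\pi(x_h,a_h)\big)^2\Big].$$ For probability measures $\mathbb P,\mathbb Q$ with a common dominating measure $\omega$, let $D_{\mathsf H}^2(\mathbb P,\mathbb Q)=\int\big(\sqrt{d\mathbb P/d\omega}-\sqrt{d\mathbb Q/d\omega}\big)^2\,d\omega$. There is an absolute constant $C>0$ such that the following holds for every such $M$ and every $R\ge 1$ for which $\sum_{h=1}^H r_h\in[0,R]$ almost surely under every policy. For all policies $\pi^\star,\hat\pi$ and every $\varepsilon\in(0,e^{-1})$, $$J(\pi^\star)-J(\hat\pi)\le\sqrt{6\,\sigma_{\pi^\star}^2\cdot D_{\mathsf H}^2\big(\mathbb P^{\hat\pi},\mathbb P^{\pi^\star}\big)}+C\,R\log(R/\varepsilon)\cdot D_{\mathsf H}^2\big(\mathbb P^{\hat\pi},\mathbb P^{\pi^\star}\big)+\varepsilon.$$ -/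

import Mathlib

open MeasureTheory ProbabilityTheory
open scoped ProbabilityTheory

/-- An episodic Markov decision process with horizon `H`, state space `X` and action space `A`.
Time steps are `h = 1, …, H`; only the values of `trans h` and `reward h` at these `h` matter. -/
structure MDP (X A : Type*) [MeasurableSpace X] [MeasurableSpace A] where
  /-- the horizon `H` -/
  H : ℕ
  /-- the law of the initial state `x₁` -/
  init : Measure X
  init_prob : IsProbabilityMeasure init
  /-- `trans h (x, a)` is the law of `x_{h+1}` given `x_h = x`, `a_h = a` -/
  trans : ℕ → Kernel (X × A) X
  trans_markov : ∀ h, IsMarkovKernel (trans h)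
  /-- the reward `r_h(x, a)` -/
  reward : ℕ → X → A → ℝ

/-- A (randomized, time-dependent) policy: `act h x` is the law of `a_h` given `x_h = x`. -/
structure Policy (X A : Type*) [MeasurableSpace X] [MeasurableSpace A] where
  act : ℕ → Kernel X A
  act_markov : ∀ h, IsMarkovKernel (act h)

attribute [instance] MDP.init_prob MDP.trans_markov Policy.act_markov

namespace MDP

variable {X A : Type*} [MeasurableSpace X] [MeasurableSpace A]

/-- `M.rollout π n h x` is the law of `(x_h, a_h), …, (x_{h+n-1}, a_{h+n-1})` when `x_h = x`,
`a_k ∼ π_k(x_k)` and `x_{k+1} ∼ P_k(x_k, a_k)`; entry `i` of the tuple is the pair of time `h + i`. -/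
noncomputable def rollout (M : MDP X A) (π : Policy X A) :
    (n h : ℕ) → Kernel X (Fin n → X × A)
  | 0, _ => Kernel.const X (Measure.dirac Fin.elim0)
  | n + 1, h =>
      (Kernel.id ×ₖ (π.act h ⊗ₖ (M.rollout π n (h + 1) ∘ₖ M.trans h))).map
        (fun z : X × A × (Fin n → X × A) => (Fin.cons (z.1, z.2.1) z.2.2 : Fin (n + 1) → X × A))

/-- The law `ℙ^π` of the trajectory `(x₁, a₁), …, (x_H, a_H)`; entry `i` is the pair of
time `i + 1`. -/
noncomputable def law (M : MDP X A) (π : Policy X A) : Measure (Fin M.H → X × A) :=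
  M.init.bind (M.rollout π M.H 1)

/-- The sum of the rewards `r_h, …, r_{h+n-1}` along a trajectory that starts at time `h`. -/
def cumReward (M : MDP X A) (h : ℕ) {n : ℕ} (o : Fin n → X × A) : ℝ :=
  ∑ i : Fin n, M.reward (h + i) (o i).1 (o i).2

/-- The expected reward `J(π) = 𝔼^π[∑_{h=1}^H r_h]`. -/
noncomputable def J (M : MDP X A) (π : Policy X A) : ℝ :=
  ∫ o, M.cumReward 1 o ∂(M.law π)

/-- `Q_h^π(x, a) = 𝔼^π[∑_{k=h}^H r_k | x_h = x, a_h = a]`, for `1 ≤ h ≤ H`. -/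
noncomputable def Q (M : MDP X A) (π : Policy X A) (h : ℕ) (x : X) (a : A) : ℝ :=
  M.reward h x a +
    ∫ o, M.cumReward (h + 1) o ∂((M.rollout π (M.H - h) (h + 1) ∘ₖ M.trans h) (x, a))

/-- The advantage gap `Q_h^π(x, π_h(x)) - Q_h^π(x, a)`, where `Q_h^π(x, π_h(x))` is the mean of
`Q_h^π(x, b)` over `b ∼ π_h(x)`. -/
noncomputable def advGap (M : MDP X A) (π : Policy X A) (h : ℕ) (x : X) (a : A) : ℝ :=
  (∫ b, M.Q π h x b ∂(π.act h x)) - M.Q π h x a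

/-- `σ_π² = ∑_{h=1}^H 𝔼^π[(Q_h^π(x_h, π_h(x_h)) - Q_h^π(x_h, a_h))²]`. -/
noncomputable def sigmaSq (M : MDP X A) (π : Policy X A) : ℝ :=
  ∑ i : Fin M.H, ∫ o, (M.advGap π (i + 1) (o i).1 (o i).2) ^ 2 ∂(M.law π)

/-- Reward normalization: the total reward lies in `[0, R]` almost surely, whatever policy is
executed. -/
def RewardNormalized (M : MDP X A) (R : ℝ) : Prop :=
  ∀ π : Policy X A, ∀ᵐ o ∂(M.law π), M.cumReward 1 o ∈ Set.Icc 0 R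

lemma measurable_consPair (n : ℕ) :
    Measurable (fun z : X × A × (Fin n → X × A) =>
      (Fin.cons (z.1, z.2.1) z.2.2 : Fin (n + 1) → X × A)) := by
  refine measurable_pi_lambda _ fun i => ?_
  refine Fin.cases ?_ (fun j => ?_) i
  · simp only [Fin.cons_zero]; fun_prop
  · simp only [Fin.cons_succ]; fun_prop

instance rollout_markov (M : MDP X A) (π : Policy X A) (n h : ℕ) :
    IsMarkovKernel (M.rollout π n h) := by
  induction n generalizing h with
  | zero => rw [rollout]; infer_instance
  | succ n ih =>
    rw [rollout]
    have := ih (h + 1)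
    exact Kernel.IsMarkovKernel.map _ (measurable_consPair n)

instance law_prob (M : MDP X A) (π : Policy X A) : IsProbabilityMeasure (M.law π) := by
  unfold law; infer_instance

end MDP

/-- The squared Hellinger distance `∫ (√(dμ/dω) - √(dν/dω))² dω`, without a factor `1/2`, with the
dominating measure `ω = μ + ν` (the value does not depend on the choice of `ω`). -/
noncomputable def hellingerSq {Ω : Type*} [MeasurableSpace Ω] (μ ν : Measure Ω) : ℝ :=
  ∫ o, (√((μ.rnDeriv (μ + ν) o).toReal) - √((ν.rnDeriv (μ + ν) o).toReal)) ^ 2 ∂(μ + ν)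

/-! ### Change of measure in squared Hellinger distance -/

section Hellinger

variable {Ω : Type*} [MeasurableSpace Ω] (μ ν : Measure Ω)

/-! Let `Z` be the sum of the advantage gaps of `π⋆` along a trajectory. By telescoping, the mean of
`Z` under any policy `ρ` is `J(π⋆) - J(ρ)`, while under `π⋆` the partial sums are a centred
martingale with final variance `σ²`. So the regret compares the means of one variable under two
laws. Writing `D` for the squared Hellinger distance, Cauchy-Schwarz
(`integral_sub_le_sqrt_hellingerSq`) bounds it by the root of `2 * D` times the two second moments,
and `integral_le_two_mul_add_hellingerSq` replaces the moment under `π̂` by twice the one under `π⋆`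
plus `2 * (sup |Z|)² * D`. Hence the 6 = 2 * (2 + 1).

This needs a bound on `|Z|` free of `H`, so `Z` is stopped once it exceeds a level `B` of order `R
log (R / ε)`. The stopped sum is at most `B + R`, its mean and variance under `π⋆` do not grow, and
stopping costs at most `R` times its probability (`RewardNormalized.J_sub_J_le`).

Stopping is rare under `π⋆`, uniformly in `H`: past reward plus value is a martingale in `[0, R]`
that moves from `v` to `q = s + Q` when the action is drawn (the gap is `v - q`) and then to the
next `v` at the transition. The upward drift of its square pays for the growth of `exp (±Z / (3R))`,
so `exp (±Z / (3R)) * (2 - (v / R)²)` is a supermartingale and the tail is at most `4 exp (-B /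
(3R))` (`Good.integral_exp_stopped_le`). The change of measure carries this tail to `π̂`. -/

lemma hellingerSq_nonneg : 0 ≤ hellingerSq μ ν := integral_nonneg fun _ => sq_nonneg _

variable [IsProbabilityMeasure μ] [IsProbabilityMeasure ν]

lemma integrable_hellinger_integrand :
    Integrable (fun o => (√((μ.rnDeriv (μ + ν) o).toReal) -
      √((ν.rnDeriv (μ + ν) o).toReal)) ^ 2) (μ + ν) := by
  have hp : Integrable (fun o => (μ.rnDeriv (μ + ν) o).toReal) (μ + ν) :=
    Measure.integrable_toReal_rnDeriv
  have hq : Integrable (fun o => (ν.rnDeriv (μ + ν) o).toReal) (μ + ν) :=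
    Measure.integrable_toReal_rnDeriv
  refine (hp.add hq).mono' ?_ (.of_forall fun o => ?_)
  · exact Measurable.aestronglyMeasurable (by fun_prop)
  · rw [Real.norm_of_nonneg (sq_nonneg _)]
    have h1 := Real.sq_sqrt (ENNReal.toReal_nonneg (a := μ.rnDeriv (μ + ν) o))
    have h2 := Real.sq_sqrt (ENNReal.toReal_nonneg (a := ν.rnDeriv (μ + ν) o))
    have := mul_nonneg (Real.sqrt_nonneg (μ.rnDeriv (μ + ν) o).toReal)
      (Real.sqrt_nonneg (ν.rnDeriv (μ + ν) o).toReal)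
    simp only [Pi.add_apply]
    nlinarith

variable {μ ν}

lemma integral_eq_integral_rnDeriv_mul_left (f : Ω → ℝ) :
    ∫ o, f o ∂μ = ∫ o, (μ.rnDeriv (μ + ν) o).toReal * f o ∂(μ + ν) :=
  (integral_rnDeriv_smul (Measure.absolutelyContinuous_of_le (Measure.le_add_right le_rfl))).symm

lemma integral_eq_integral_rnDeriv_mul_right (f : Ω → ℝ) :
    ∫ o, f o ∂ν = ∫ o, (ν.rnDeriv (μ + ν) o).toReal * f o ∂(μ + ν) :=
  (integral_rnDeriv_smul (Measure.absolutelyContinuous_of_le (Measure.le_add_left le_rfl))).symm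

/-- A nonnegative bounded function has comparable means under measures that are close in
Hellinger distance. -/
lemma integral_le_two_mul_add_hellingerSq {f : Ω → ℝ} (hf : Measurable f) {K : ℝ}
    (hμ : ∀ᵐ o ∂μ, 0 ≤ f o ∧ f o ≤ K) (hν : ∀ᵐ o ∂ν, 0 ≤ f o ∧ f o ≤ K) :
    ∫ o, f o ∂μ ≤ 2 * ∫ o, f o ∂ν + 2 * K * hellingerSq μ ν := by
  have hω : ∀ᵐ o ∂(μ + ν), 0 ≤ f o ∧ f o ≤ K := ae_add_measure_iff.2 ⟨hμ, hν⟩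
  have hb : ∀ᵐ o ∂(μ + ν), ‖f o‖ ≤ K := hω.mono fun o h => by
    rw [Real.norm_of_nonneg h.1]; exact h.2
  have hD := integrable_hellinger_integrand μ ν
  have hp : Integrable (fun o => (μ.rnDeriv (μ + ν) o).toReal * f o) (μ + ν) :=
    Measure.integrable_toReal_rnDeriv.mul_bdd hf.aestronglyMeasurable hb
  have hq : Integrable (fun o => (ν.rnDeriv (μ + ν) o).toReal * f o) (μ + ν) :=
    Measure.integrable_toReal_rnDeriv.mul_bdd hf.aestronglyMeasurable hb
  rw [integral_eq_integral_rnDeriv_mul_left (ν := ν), hellingerSq,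
    integral_eq_integral_rnDeriv_mul_right (μ := μ) (ν := ν), ← integral_const_mul,
    ← integral_const_mul, ← integral_add (hq.const_mul 2) (hD.const_mul _)]
  refine integral_mono_ae hp ((hq.const_mul 2).add (hD.const_mul _)) (hω.mono fun o h => ?_)
  have h1 := Real.sq_sqrt (ENNReal.toReal_nonneg (a := μ.rnDeriv (μ + ν) o))
  have h2 := Real.sq_sqrt (ENNReal.toReal_nonneg (a := ν.rnDeriv (μ + ν) o))
  set p := (μ.rnDeriv (μ + ν) o).toReal
  set q := (ν.rnDeriv (μ + ν) o).toReal
  -- The right side minus the left is exactly `(√p - 2√q)²`.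
  have h3 : p ≤ 2 * q + 2 * (√p - √q) ^ 2 := by nlinarith [sq_nonneg (√p - 2 * √q)]
  have h4 := mul_le_mul_of_nonneg_right h3 h.1
  have h5 := mul_le_mul_of_nonneg_left h.2 (sq_nonneg (√p - √q))
  nlinarith

/-- The means of a bounded function under two measures differ by at most its second moments times
the Hellinger distance. -/
lemma integral_sub_le_sqrt_hellingerSq {f : Ω → ℝ} (hf : Measurable f) {K : ℝ}
    (hμ : ∀ᵐ o ∂μ, |f o| ≤ K) (hν : ∀ᵐ o ∂ν, |f o| ≤ K) :
    ∫ o, f o ∂μ - ∫ o, f o ∂ν ≤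
      √(2 * hellingerSq μ ν * (∫ o, f o ^ 2 ∂μ + ∫ o, f o ^ 2 ∂ν)) := by
  have hω : ∀ᵐ o ∂(μ + ν), |f o| ≤ K := ae_add_measure_iff.2 ⟨hμ, hν⟩
  have hb : ∀ᵐ o ∂(μ + ν), ‖f o‖ ≤ K := hω
  have hb2 : ∀ᵐ o ∂(μ + ν), ‖f o ^ 2‖ ≤ K ^ 2 := hω.mono fun o h => by
    rw [norm_pow]; exact pow_le_pow_left₀ (norm_nonneg _) h 2
  have hf2 : Measurable fun o => f o ^ 2 := by fun_prop
  have hD := integrable_hellinger_integrand μ ν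
  have hp : Integrable (fun o => (μ.rnDeriv (μ + ν) o).toReal * f o) (μ + ν) :=
    Measure.integrable_toReal_rnDeriv.mul_bdd hf.aestronglyMeasurable hb
  have hq : Integrable (fun o => (ν.rnDeriv (μ + ν) o).toReal * f o) (μ + ν) :=
    Measure.integrable_toReal_rnDeriv.mul_bdd hf.aestronglyMeasurable hb
  have hp2 : Integrable (fun o => (μ.rnDeriv (μ + ν) o).toReal * f o ^ 2) (μ + ν) :=
    Measure.integrable_toReal_rnDeriv.mul_bdd hf2.aestronglyMeasurable hb2
  have hq2 : Integrable (fun o => (ν.rnDeriv (μ + ν) o).toReal * f o ^ 2) (μ + ν) :=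
    Measure.integrable_toReal_rnDeriv.mul_bdd hf2.aestronglyMeasurable hb2
  refine Real.le_sqrt_of_sq_le ?_
  -- Cauchy-Schwarz by discriminant. With `a = √p`, `b = √q` for the densities `p`, `q`, the
  -- integrand is `(t(a - b) - f(a + b))² + (f(a - b))²`, since `(a + b)² + (a - b)² = 2(p + q)`.
  have key : ∀ t : ℝ, 0 ≤ hellingerSq μ ν * (t * t) +
      (-2 * (∫ o, f o ∂μ - ∫ o, f o ∂ν)) * t + 2 * (∫ o, f o ^ 2 ∂μ + ∫ o, f o ^ 2 ∂ν) := by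
    intro t
    have hi1 : Integrable (fun o => (-2 * t) * ((μ.rnDeriv (μ + ν) o).toReal * f o -
        (ν.rnDeriv (μ + ν) o).toReal * f o)) (μ + ν) := (hp.sub hq).const_mul _
    have hi2 : Integrable (fun o => 2 * ((μ.rnDeriv (μ + ν) o).toReal * f o ^ 2 +
        (ν.rnDeriv (μ + ν) o).toReal * f o ^ 2)) (μ + ν) := (hp2.add hq2).const_mul _
    have hi0 := hD.const_mul (t * t)
    have hi01 : Integrable (fun o => (t * t) * (√((μ.rnDeriv (μ + ν) o).toReal) -
        √((ν.rnDeriv (μ + ν) o).toReal)) ^ 2 + (-2 * t) * ((μ.rnDeriv (μ + ν) o).toReal * f o -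
        (ν.rnDeriv (μ + ν) o).toReal * f o)) (μ + ν) := hi0.add hi1
    have hnn : 0 ≤ ∫ o, ((t * t) * (√((μ.rnDeriv (μ + ν) o).toReal) -
        √((ν.rnDeriv (μ + ν) o).toReal)) ^ 2 + (-2 * t) * ((μ.rnDeriv (μ + ν) o).toReal * f o -
        (ν.rnDeriv (μ + ν) o).toReal * f o)) + 2 * ((μ.rnDeriv (μ + ν) o).toReal * f o ^ 2 +
        (ν.rnDeriv (μ + ν) o).toReal * f o ^ 2) ∂(μ + ν) := by
      refine integral_nonneg fun o => ?_
      have h1 := Real.sq_sqrt (ENNReal.toReal_nonneg (a := μ.rnDeriv (μ + ν) o))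
      have h2 := Real.sq_sqrt (ENNReal.toReal_nonneg (a := ν.rnDeriv (μ + ν) o))
      simp only [Pi.zero_apply]
      set a := √((μ.rnDeriv (μ + ν) o).toReal)
      set b := √((ν.rnDeriv (μ + ν) o).toReal)
      rw [← h1, ← h2]
      nlinarith [sq_nonneg (t * (a - b) - f o * (a + b)), sq_nonneg (f o * (a - b))]
    rw [integral_add hi01 hi2, integral_add hi0 hi1,
      integral_const_mul, integral_const_mul, integral_const_mul, integral_sub hp hq,
      integral_add hp2 hq2, ← integral_eq_integral_rnDeriv_mul_left,
      ← integral_eq_integral_rnDeriv_mul_right, ← integral_eq_integral_rnDeriv_mul_left,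
      ← integral_eq_integral_rnDeriv_mul_right] at hnn
    rw [hellingerSq]
    linarith
  have := discrim_le_zero key
  rw [discrim] at this
  nlinarith

end Hellinger

/-! ### The recursive structure of trajectories -/

namespace MDP

variable {X A : Type*} [MeasurableSpace X] [MeasurableSpace A] (M : MDP X A) (π : Policy X A)

lemma rollout_succ_apply (n h : ℕ) (x : X) :
    M.rollout π (n + 1) h x = ((π.act h x) ⊗ₘ ((M.rollout π n (h + 1) ∘ₖ M.trans h).sectR x)).map
      (fun z : A × (Fin n → X × A) => (Fin.cons (x, z.1) z.2 : Fin (n + 1) → X × A)) := by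
  rw [rollout, Kernel.map_apply _ (measurable_consPair n), Kernel.prod_apply, Kernel.id_apply,
    Measure.dirac_prod, Measure.map_map (measurable_consPair n) (by fun_prop),
    Kernel.compProd_apply_eq_compProd_sectR]
  rfl

lemma rollout_zero_apply (h : ℕ) (x : X) :
    M.rollout π 0 h x = Measure.dirac Fin.elim0 := by
  rw [rollout]; rfl

lemma cumReward_cons (h n : ℕ) (x : X) (a : A) (o : Fin n → X × A) :
    M.cumReward h (Fin.cons (x, a) o : Fin (n + 1) → X × A) =
      M.reward h x a + M.cumReward (h + 1) o := by
  simp only [cumReward, Fin.sum_univ_succ, Fin.cons_zero, Fin.cons_succ, Fin.val_zero, add_zero,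
    Fin.val_succ]
  congr 1
  refine Finset.sum_congr rfl fun i _ => ?_
  rw [show h + (i.val + 1) = h + 1 + i.val by ring]

lemma integral_law {f : (Fin M.H → X × A) → ℝ} (hf : Integrable f (M.law π)) :
    ∫ o, f o ∂(M.law π) = ∫ x, ∫ o, f o ∂(M.rollout π M.H 1 x) ∂M.init := by
  rw [law, Measure.comp_eq_comp_const_apply] at *
  exact Kernel.integral_comp hf

lemma integral_law_le {f : (Fin M.H → X × A) → ℝ} (hf : Integrable f (M.law π)) {φ : X → ℝ}
    (hφ : Integrable φ M.init) (h : ∀ᵐ x ∂M.init, ∫ o, f o ∂(M.rollout π M.H 1 x) ≤ φ x) :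
    ∫ o, f o ∂(M.law π) ≤ ∫ x, φ x ∂M.init := by
  rw [integral_law M π hf]
  refine integral_mono_ae ?_ hφ h
  rw [law, Measure.comp_eq_comp_const_apply] at hf
  exact hf.integral_comp

variable [Countable X] [DiscreteMeasurableSpace X] [Countable A] [DiscreteMeasurableSpace A]

lemma ae_rollout_succ {n h : ℕ} {x : X} {p : (Fin (n + 1) → X × A) → Prop} :
    (∀ᵐ o ∂(M.rollout π (n + 1) h x), p o) ↔ ∀ᵐ a ∂(π.act h x), ∀ᵐ y ∂(M.trans h (x, a)),
      ∀ᵐ o ∂(M.rollout π n (h + 1) y), p (Fin.cons (x, a) o) := by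
  rw [rollout_succ_apply, ae_map_iff (by fun_prop) .of_discrete,
    Measure.ae_compProd_iff .of_discrete]
  simp only [Kernel.sectR_apply, Kernel.ae_comp_iff (MeasurableSet.of_discrete)]

lemma ae_law {p : (Fin M.H → X × A) → Prop} :
    (∀ᵐ o ∂(M.law π), p o) ↔ ∀ᵐ x ∂M.init, ∀ᵐ o ∂(M.rollout π M.H 1 x), p o :=
  Measure.ae_comp_iff .of_discrete

section

variable {M π}

lemma integrable_cons {n h : ℕ} {x : X} {f : (Fin (n + 1) → X × A) → ℝ}
    (hf : Integrable f (M.rollout π (n + 1) h x)) :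
    Integrable (fun z : A × (Fin n → X × A) => f (Fin.cons (x, z.1) z.2))
      ((π.act h x) ⊗ₘ ((M.rollout π n (h + 1) ∘ₖ M.trans h).sectR x)) := by
  rw [rollout_succ_apply] at hf
  exact (integrable_map_measure .of_discrete (by fun_prop)).1 hf

lemma integral_rollout_succ {n h : ℕ} {x : X} {f : (Fin (n + 1) → X × A) → ℝ}
    (hf : Integrable f (M.rollout π (n + 1) h x)) :
    ∫ o, f o ∂(M.rollout π (n + 1) h x) =
      ∫ a, ∫ o, f (Fin.cons (x, a) o) ∂((M.rollout π n (h + 1) ∘ₖ M.trans h) (x, a))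
        ∂(π.act h x) := by
  rw [rollout_succ_apply, integral_map (by fun_prop) .of_discrete,
    Measure.integral_compProd (integrable_cons hf)]
  rfl

/-- An upper bound on a mean over trajectories, from one on the first step. -/
lemma integral_rollout_succ_le {n h : ℕ} {x : X} {f : (Fin (n + 1) → X × A) → ℝ}
    (hf : Integrable f (M.rollout π (n + 1) h x)) {φ : A → X → ℝ} {ψ : A → ℝ}
    (hφ : ∀ a, Integrable (φ a) (M.trans h (x, a))) (hψ : Integrable ψ (π.act h x))
    (h₁ : ∀ a, ∀ᵐ y ∂(M.trans h (x, a)),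
      ∫ o, f (Fin.cons (x, a) o) ∂(M.rollout π n (h + 1) y) ≤ φ a y)
    (h₂ : ∀ a, ∫ y, φ a y ∂(M.trans h (x, a)) ≤ ψ a) :
    ∫ o, f o ∂(M.rollout π (n + 1) h x) ≤ ∫ a, ψ a ∂(π.act h x) := by
  have hc := integrable_cons hf
  have hi := (Measure.integrable_compProd_iff .of_discrete).1 hc
  rw [integral_rollout_succ hf]
  refine integral_mono_ae ?_ hψ (hi.1.mono fun a ha => ?_)
  · rw [Measure.compProd] at hc
    exact hc.integral_compProd
  refine le_trans ?_ (h₂ a)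
  simp only [Kernel.sectR_apply] at ha ⊢
  rw [Kernel.integral_comp ha]
  exact integral_mono_ae ha.integral_comp (hφ a) (h₁ a)

end

end MDP

/-! ### Rewards under every choice of actions -/

/-- A Poisson law pushed along an enumeration of `A` charges every action. A policy that plays it in
every state turns an almost sure reward bound into one valid for every action. -/
lemma exists_isProbabilityMeasure_full (A : Type*) [Nonempty A] [Countable A] [MeasurableSpace A]
    [DiscreteMeasurableSpace A] :
    ∃ μ : Measure A, IsProbabilityMeasure μ ∧ ∀ p : A → Prop, (∀ᵐ a ∂μ, p a) → ∀ a, p a := by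
  obtain ⟨e, he⟩ := exists_surjective_nat A
  refine ⟨(poissonMeasure 1).map e, Measure.isProbabilityMeasure_map (by fun_prop), ?_⟩
  intro p hp a
  obtain ⟨k, rfl⟩ := he a
  rw [ae_map_iff (by fun_prop) .of_discrete, ae_iff_of_countable] at hp
  refine hp k ?_
  have := poissonMeasure_real_singleton_pos k (zero_lt_one' NNReal)
  exact fun h0 => by simp [measureReal_def, h0] at this

lemma integral_add_mem_Icc {Ω : Type*} [MeasurableSpace Ω] {μ : Measure Ω}
    [IsProbabilityMeasure μ] {f : Ω → ℝ} (hf : Integrable f μ) {s a b : ℝ}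
    (h : ∀ᵐ o ∂μ, s + f o ∈ Set.Icc a b) : s + ∫ o, f o ∂μ ∈ Set.Icc a b := by
  have h1 : s + ∫ o, f o ∂μ = ∫ o, (s + f o) ∂μ := by
    rw [integral_add (integrable_const _) hf]; simp
  rw [h1]
  have hi : Integrable (fun o => s + f o) μ := (integrable_const _).add hf
  constructor
  · have := integral_mono_ae (integrable_const a) hi (h.mono fun o ho => ho.1)
    simpa using this
  · have := integral_mono_ae hi (integrable_const b) (h.mono fun o ho => ho.2)
    simpa using this

namespace MDP

variable {X A : Type*} [MeasurableSpace X] [MeasurableSpace A]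

/-- From state `x` at time `h`, after a past reward of `s` and with `n` steps left, the total reward
surely ends up in `[0, R]`, whatever actions are taken. -/
def Good (M : MDP X A) (R : ℝ) : (n h : ℕ) → X → ℝ → Prop
  | 0, _, _, s => s ∈ Set.Icc 0 R
  | n + 1, h, x, s => ∀ a, ∀ᵐ y ∂(M.trans h (x, a)), M.Good R n (h + 1) y (s + M.reward h x a)

/-- The mean of the next `n` rewards from state `x` at time `h`. -/
noncomputable def value (M : MDP X A) (π : Policy X A) (n h : ℕ) (x : X) : ℝ :=
  ∫ o, M.cumReward h o ∂(M.rollout π n h x)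

variable {M : MDP X A} {π : Policy X A} {R : ℝ}

lemma Q_eq {h n : ℕ} (hn : h + n = M.H) (x : X) (a : A) :
    M.Q π h x a = M.reward h x a +
      ∫ o, M.cumReward (h + 1) o ∂((M.rollout π n (h + 1) ∘ₖ M.trans h) (x, a)) := by
  obtain rfl : n = M.H - h := by omega
  rfl

lemma value_zero (h : ℕ) (x : X) : M.value π 0 h x = 0 := by
  simp [value, cumReward]

variable [Countable X] [DiscreteMeasurableSpace X] [Countable A] [DiscreteMeasurableSpace A]

lemma good_of_ae_rollout (hπ : ∀ h x (p : A → Prop), (∀ᵐ a ∂(π.act h x), p a) → ∀ a, p a)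
    (n h : ℕ) (x : X) (s : ℝ)
    (H : ∀ᵐ o ∂(M.rollout π n h x), s + M.cumReward h o ∈ Set.Icc 0 R) : M.Good R n h x s := by
  induction n generalizing h x s with
  | zero => simpa [rollout_zero_apply, cumReward, Good] using H
  | succ n ih =>
    rw [ae_rollout_succ] at H
    intro a
    filter_upwards [hπ h x _ H a] with y hy
    refine ih _ _ _ ?_
    filter_upwards [hy] with o ho
    rwa [cumReward_cons, ← add_assoc] at ho

lemma RewardNormalized.good (hR : M.RewardNormalized R) (π : Policy X A) :
    ∀ᵐ x ∂M.init, M.Good R M.H 1 x 0 := by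
  have : Nonempty X := M.init.nonempty_of_neZero
  -- `π` serves only to show that `A` is nonempty; the bound is read off from the fully supported
  -- policy `ρ`.
  have : Nonempty A := (π.act 0 (Classical.arbitrary X)).nonempty_of_neZero
  obtain ⟨μ, hμ, hfull⟩ := exists_isProbabilityMeasure_full A
  let ρ : Policy X A := ⟨fun _ => Kernel.const X μ, fun _ => inferInstance⟩
  filter_upwards [(M.ae_law ρ).1 (hR ρ)] with x hx
  exact good_of_ae_rollout (π := ρ) (fun h x => hfull) _ _ _ _ (by simpa using hx)

lemma Good.ae {n h : ℕ} {x : X} {s : ℝ} (hg : M.Good R n h x s) (π : Policy X A) :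
    ∀ᵐ o ∂(M.rollout π n h x), s + M.cumReward h o ∈ Set.Icc 0 R := by
  induction n generalizing h x s with
  | zero => exact .of_forall fun o => by simpa [cumReward, Good] using hg
  | succ n ih =>
    rw [ae_rollout_succ]
    refine .of_forall fun a => ?_
    filter_upwards [hg a] with y hy
    filter_upwards [ih hy] with o ho
    rwa [cumReward_cons, ← add_assoc]

lemma Good.integrable_cumReward {n h : ℕ} {x : X} {s : ℝ} (hg : M.Good R n h x s)
    (π : Policy X A) : Integrable (fun o => M.cumReward h o) (M.rollout π n h x) := by
  refine .of_bound .of_discrete (R + |s|) ?_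
  filter_upwards [hg.ae π] with o ho
  rw [Real.norm_eq_abs, abs_le]
  constructor <;> cases abs_cases s <;> linarith [ho.1, ho.2]

/-- Adding the past reward `s` keeps the range `[0, R]` the same at every step; this is what makes
later bounds free of the horizon. -/
lemma Good.value_mem {n h : ℕ} {x : X} {s : ℝ} (hg : M.Good R n h x s) (π : Policy X A) :
    s + M.value π n h x ∈ Set.Icc 0 R :=
  integral_add_mem_Icc (hg.integrable_cumReward π) (hg.ae π)

section Step

variable {n h : ℕ} {x : X} {s : ℝ}

lemma Good.ae_value_mem (hg : M.Good R (n + 1) h x s) (π : Policy X A) (a : A) :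
    ∀ᵐ y ∂(M.trans h (x, a)),
      s + (M.reward h x a + M.value π n (h + 1) y) ∈ Set.Icc 0 R := by
  filter_upwards [hg a] with y hy
  rw [← add_assoc]
  exact hy.value_mem π

lemma Good.integrable_value (hg : M.Good R (n + 1) h x s) (π : Policy X A) (a : A) :
    Integrable (fun y => M.value π n (h + 1) y) (M.trans h (x, a)) := by
  refine .of_bound .of_discrete (R + |s + M.reward h x a|) ?_
  filter_upwards [hg.ae_value_mem π a] with o ho
  rw [Real.norm_eq_abs, abs_le]
  constructor <;> cases abs_cases (s + M.reward h x a) <;> linarith [ho.1, ho.2]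

lemma Good.integrable_reward_add_value (hg : M.Good R (n + 1) h x s) (π : Policy X A) (a : A) :
    Integrable (fun y => M.reward h x a + M.value π n (h + 1) y) (M.trans h (x, a)) :=
  (integrable_const _).add (hg.integrable_value π a)

lemma Good.integrable_cumReward_comp (hg : M.Good R (n + 1) h x s) (π : Policy X A) (a : A) :
    Integrable (fun o => M.cumReward (h + 1) o)
      ((M.rollout π n (h + 1) ∘ₖ M.trans h) (x, a)) := by
  refine .of_bound .of_discrete (R + |s + M.reward h x a|) ?_
  rw [Kernel.ae_comp_iff .of_discrete]
  filter_upwards [hg a] with y hy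
  filter_upwards [hy.ae π] with o ho
  rw [Real.norm_eq_abs, abs_le]
  constructor <;> cases abs_cases (s + M.reward h x a) <;> linarith [ho.1, ho.2]

/-- Makes `Q` the midpoint of a step: the mean of what follows the transition, to which Jensen
applies in the tail bound. -/
lemma Good.Q_eq_integral_value (hg : M.Good R (n + 1) h x s) (hn : h + n = M.H)
    (π : Policy X A) (a : A) :
    M.Q π h x a = ∫ y, (M.reward h x a + M.value π n (h + 1) y) ∂(M.trans h (x, a)) := by
  rw [integral_add (integrable_const _) (hg.integrable_value π a), Q_eq hn, Kernel.integral_comp]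
  · simp [value]
  · exact hg.integrable_cumReward_comp π a

lemma Good.Q_mem (hg : M.Good R (n + 1) h x s) (hn : h + n = M.H) (π : Policy X A) (a : A) :
    s + M.Q π h x a ∈ Set.Icc 0 R := by
  rw [hg.Q_eq_integral_value hn]
  exact integral_add_mem_Icc (hg.integrable_reward_add_value π a) (hg.ae_value_mem π a)

lemma Good.integrable_Q (hg : M.Good R (n + 1) h x s) (hn : h + n = M.H)
    (π ρ : Policy X A) : Integrable (fun a => M.Q π h x a) (ρ.act h x) := by
  refine .of_bound .of_discrete (R + |s|) (.of_forall fun a => ?_)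
  have ho := hg.Q_mem hn π a
  rw [Real.norm_eq_abs, abs_le]
  constructor <;> cases abs_cases s <;> linarith [ho.1, ho.2]

lemma Good.integral_Q (hg : M.Good R (n + 1) h x s) (hn : h + n = M.H) (π : Policy X A) :
    ∫ a, M.Q π h x a ∂(π.act h x) = M.value π (n + 1) h x := by
  rw [value, integral_rollout_succ (hg.integrable_cumReward π)]
  refine integral_congr_ae (.of_forall fun a => ?_)
  simp only [cumReward_cons]
  rw [integral_add (integrable_const _) (hg.integrable_cumReward_comp π a), Q_eq hn]
  simp

lemma Good.advGap_eq (hg : M.Good R (n + 1) h x s) (hn : h + n = M.H) (π : Policy X A) (a : A) :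
    M.advGap π h x a = M.value π (n + 1) h x - M.Q π h x a := by
  rw [advGap, hg.integral_Q hn]

/-- The gap is a difference of two points of `[0, R]`, as the past reward cancels. -/
lemma Good.abs_advGap_le (hg : M.Good R (n + 1) h x s) (hn : h + n = M.H) (π : Policy X A)
    (a : A) : |M.advGap π h x a| ≤ R := by
  have h1 := hg.Q_mem hn π a
  have h2 := hg.value_mem π
  rw [hg.advGap_eq hn, abs_le]
  constructor <;> linarith [h1.1, h1.2, h2.1, h2.2]

lemma Good.integrable_advGap (hg : M.Good R (n + 1) h x s) (hn : h + n = M.H)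
    (π ρ : Policy X A) : Integrable (fun a => M.advGap π h x a) (ρ.act h x) :=
  .of_bound .of_discrete R (.of_forall fun a => hg.abs_advGap_le hn π a)

lemma Good.integral_advGap (hg : M.Good R (n + 1) h x s) (hn : h + n = M.H) (π : Policy X A) :
    ∫ a, M.advGap π h x a ∂(π.act h x) = 0 := by
  simp only [advGap]
  rw [integral_sub (integrable_const _) (hg.integrable_Q hn π π)]
  simp

end Step

end MDP

/-! ### The stopped sum of advantage gaps -/

/-- The one-step inequality behind the exponential supermartingale: `γ` is a centred decrement of a
quantity that moves from `w` to `w - γ` inside `[0, 1]`. -/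
lemma exp_mul_two_sub_sq_le {w γ : ℝ} (hw : w ∈ Set.Icc (0 : ℝ) 1)
    (hwγ : w - γ ∈ Set.Icc (0 : ℝ) 1) :
    Real.exp (γ / 3) * (2 - (w - γ) ^ 2) ≤ 2 - w ^ 2 + γ * (2 * w + (2 - w ^ 2) / 3) ∧
    Real.exp (-(γ / 3)) * (2 - (w - γ) ^ 2) ≤ 2 - w ^ 2 + γ * (2 * w - (2 - w ^ 2) / 3) := by
  obtain ⟨hw0, hw1⟩ := hw
  obtain ⟨hg0, hg1⟩ := hwγ
  have hexp : ∀ t : ℝ, |t| ≤ 1 → Real.exp t ≤ 1 + t + t ^ 2 := fun t ht => by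
    have := (abs_le.1 (Real.abs_exp_sub_one_sub_id_le ht)).2
    linarith
  have hγ : |γ / 3| ≤ 1 := by rw [abs_le]; constructor <;> linarith
  have hpos : 0 ≤ 2 - (w - γ) ^ 2 := by nlinarith
  have hsq := sq_nonneg γ
  constructor
  · refine (mul_le_mul_of_nonneg_right (hexp _ hγ) hpos).trans ?_
    -- What remains after the linear terms, with `exp` replaced by its quadratic bound. Since `2w -
    -- γ = w + (w - γ) ≤ 2`, the bracket is at most `-1 + 2/3 + 2/9 < 0`; the rate 1/3 is small
    -- enough for this.
    have : γ ^ 2 * (-1 + (2 * w - γ) / 3 + (2 - (w - γ) ^ 2) / 9) ≤ 0 :=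
      mul_nonpos_of_nonneg_of_nonpos hsq (by nlinarith [sq_nonneg (w - γ)])
    nlinarith
  · refine (mul_le_mul_of_nonneg_right (hexp _ (by rwa [abs_neg])) hpos).trans ?_
    have : γ ^ 2 * (-1 - (2 * w - γ) / 3 + (2 - (w - γ) ^ 2) / 9) ≤ 0 :=
      mul_nonpos_of_nonneg_of_nonpos hsq (by nlinarith [sq_nonneg (w - γ)])
    nlinarith

/-- The sum `z + g h (o 0) + g (h + 1) (o 1) + ⋯`, stopped once it exceeds `B` in absolute value. -/
noncomputable def stoppedSum {S : Type*} (g : ℕ → S → ℝ) (B : ℝ) :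
    (n h : ℕ) → ℝ → (Fin n → S) → ℝ
  | 0, _, z, _ => z
  | n + 1, h, z, o =>
      if B < |z| then z else stoppedSum g B n (h + 1) (z + g h (o 0)) (Fin.tail o)

section StoppedSum

variable {S : Type*} {g : ℕ → S → ℝ} {B z : ℝ} {n h : ℕ}

lemma stoppedSum_of_lt (hz : B < |z|) (o : Fin n → S) : stoppedSum g B n h z o = z := by
  cases n with
  | zero => rfl
  | succ n => rw [stoppedSum, if_pos hz]

lemma stoppedSum_cons (hz : ¬ B < |z|) (p : S) (o : Fin n → S) :
    stoppedSum g B (n + 1) h z (Fin.cons p o) = stoppedSum g B n (h + 1) (z + g h p) o := by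
  rw [stoppedSum, if_neg hz, Fin.cons_zero, Fin.tail_cons]

end StoppedSum

namespace MDP

variable {X A : Type*} [MeasurableSpace X] [MeasurableSpace A]

/-- The sum of the advantage gaps of `π` along a trajectory, stopped above level `B`. -/
noncomputable def stoppedGap (M : MDP X A) (π : Policy X A) (B : ℝ) (n h : ℕ) (z : ℝ)
    (o : Fin n → X × A) : ℝ :=
  stoppedSum (fun k p => M.advGap π k p.1 p.2) B n h z o

/-- The sum of the squared advantage gaps of `π` along a trajectory. -/
noncomputable def sumSqGap (M : MDP X A) (π : Policy X A) (h : ℕ) {n : ℕ} (o : Fin n → X × A) : ℝ :=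
  ∑ i : Fin n, (M.advGap π (h + i) (o i).1 (o i).2) ^ 2

variable {M : MDP X A} {R B z s : ℝ} {n h : ℕ} {x : X} {π ρ : Policy X A}

lemma stoppedGap_zero (o : Fin 0 → X × A) : M.stoppedGap π B 0 h z o = z := rfl

lemma stoppedGap_of_lt (hz : B < |z|) (o : Fin n → X × A) : M.stoppedGap π B n h z o = z :=
  stoppedSum_of_lt hz o

lemma stoppedGap_cons (hz : ¬ B < |z|) (x : X) (a : A) (o : Fin n → X × A) :
    M.stoppedGap π B (n + 1) h z (Fin.cons (x, a) o) =
      M.stoppedGap π B n (h + 1) (z + M.advGap π h x a) o :=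
  stoppedSum_cons hz _ o

lemma sumSqGap_cons (x : X) (a : A) (o : Fin n → X × A) :
    M.sumSqGap π h (Fin.cons (x, a) o : Fin (n + 1) → X × A) =
      M.advGap π h x a ^ 2 + M.sumSqGap π (h + 1) o := by
  simp only [sumSqGap, Fin.sum_univ_succ, Fin.cons_zero, Fin.cons_succ, Fin.val_zero, add_zero,
    Fin.val_succ]
  congr 1
  refine Finset.sum_congr rfl fun i _ => ?_
  rw [show h + (i.val + 1) = h + 1 + i.val by ring]

lemma sumSqGap_nonneg (o : Fin n → X × A) : 0 ≤ M.sumSqGap π h o :=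
  Finset.sum_nonneg fun _ _ => sq_nonneg _

/-- The potential of the exponential supermartingale. -/
noncomputable def potential (R z v : ℝ) : ℝ :=
  (Real.exp (z / R / 3) + Real.exp (-(z / R / 3))) * (2 - (v / R) ^ 2)

/-- The factor `2 - (v / R)²` stays in `[1, 2]`, so the potential dominates the exponential of
`|z|`, whatever the sign of `z`. -/
lemma exp_le_potential {v : ℝ} (hR : 0 < R) (hv : v ∈ Set.Icc 0 R) (hz : B < |z|) :
    Real.exp (B / R / 3) ≤ potential R z v := by
  have h1 : Real.exp (B / R / 3) ≤ Real.exp (z / R / 3) + Real.exp (-(z / R / 3)) := by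
    rcases lt_abs.1 hz with h | h
    · have : Real.exp (B / R / 3) ≤ Real.exp (z / R / 3) := by gcongr
      linarith [Real.exp_pos (-(z / R / 3))]
    · have : Real.exp (B / R / 3) ≤ Real.exp (-z / R / 3) := by gcongr
      rw [neg_div, neg_div] at this
      linarith [Real.exp_pos (z / R / 3)]
  have h2 : (1 : ℝ) ≤ 2 - (v / R) ^ 2 := by
    have h0 : 0 ≤ v / R := div_nonneg hv.1 hR.le
    have h1 : v / R ≤ 1 := (div_le_one hR).2 hv.2
    nlinarith
  have := Real.exp_pos (B / R / 3)
  rw [potential]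
  nlinarith

lemma potential_nonneg {v : ℝ} (hR : 0 < R) (hv : v ∈ Set.Icc 0 R) : 0 ≤ potential R z v := by
  have h0 : 0 ≤ v / R := div_nonneg hv.1 hR.le
  have h1 : v / R ≤ 1 := (div_le_one hR).2 hv.2
  exact mul_nonneg (by positivity) (by nlinarith)

lemma potential_le {v : ℝ} : potential R z v ≤
    2 * (Real.exp (z / R / 3) + Real.exp (-(z / R / 3))) := by
  have h0 : 0 < Real.exp (z / R / 3) + Real.exp (-(z / R / 3)) := by positivity
  rw [potential]
  nlinarith [sq_nonneg (v / R)]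

/-- The potential decreases in the mean, up to a linear term in the gap. -/
lemma potential_add_le {v q : ℝ} (hR : 0 < R) (hv : v ∈ Set.Icc 0 R) (hq : q ∈ Set.Icc 0 R) :
    potential R (z + (v - q)) q ≤ potential R z v + (v - q) *
      ((Real.exp (z / R / 3) * (2 * (v / R) + (2 - (v / R) ^ 2) / 3) +
        Real.exp (-(z / R / 3)) * (2 * (v / R) - (2 - (v / R) ^ 2) / 3)) / R) := by
  have hI : ∀ {u : ℝ}, u ∈ Set.Icc 0 R → u / R ∈ Set.Icc (0 : ℝ) 1 := fun hu =>
    ⟨div_nonneg hu.1 hR.le, (div_le_one hR).2 hu.2⟩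
  have hq' : v / R - (v - q) / R = q / R := by ring
  obtain ⟨h1, h2⟩ := exp_mul_two_sub_sq_le (w := v / R) (γ := (v - q) / R) (hI hv)
    (by rw [hq']; exact hI hq)
  rw [hq'] at h1 h2
  have e1 : (z + (v - q)) / R / 3 = z / R / 3 + (v - q) / R / 3 := by ring
  have h1' := mul_le_mul_of_nonneg_left h1 (Real.exp_pos (z / R / 3)).le
  have h2' := mul_le_mul_of_nonneg_left h2 (Real.exp_pos (-(z / R / 3))).le
  rw [potential, potential, e1, neg_add, Real.exp_add, Real.exp_add]
  have e2 : ∀ c : ℝ, (v - q) * (c / R) = (v - q) / R * c := fun c => by ring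
  rw [e2]
  nlinarith

variable [Countable X] [DiscreteMeasurableSpace X] [Countable A] [DiscreteMeasurableSpace A]

/-! ### Range, moments and tail of the stopped sum along a rollout -/

/-- The level is tested before each addition, so the overshoot is at most one gap. The condition
`hn` makes the rollout end exactly at time `H`, up to which `Q` counts rewards. -/
lemma Good.ae_abs_stoppedGap_le (hg : M.Good R n h x s) (hn : h + n = M.H + 1) (π ρ : Policy X A)
    (hz : |z| ≤ B + R) : ∀ᵐ o ∂(M.rollout ρ n h x), |M.stoppedGap π B n h z o| ≤ B + R := by
  induction n generalizing h x s z with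
  | zero => exact .of_forall fun o => hz
  | succ n ih =>
    by_cases hB : B < |z|
    · exact .of_forall fun o => by rwa [stoppedGap_of_lt hB]
    rw [ae_rollout_succ]
    refine .of_forall fun a => ?_
    filter_upwards [hg a] with y hy
    have hgap := hg.abs_advGap_le (by omega) π a
    filter_upwards [ih hy (by omega) (z := z + M.advGap π h x a)
      ((abs_add_le _ _).trans (by linarith))] with o ho
    rwa [stoppedGap_cons hB]

lemma Good.ae_advGap_sq_le (hg : M.Good R n h x s) (hn : h + n = M.H + 1) (π ρ : Policy X A) :
    ∀ᵐ o ∂(M.rollout ρ n h x), ∀ i : Fin n, M.advGap π (h + i) (o i).1 (o i).2 ^ 2 ≤ R ^ 2 := by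
  induction n generalizing h x s with
  | zero => exact .of_forall fun o i => i.elim0
  | succ n ih =>
    rw [ae_rollout_succ]
    refine .of_forall fun a => ?_
    filter_upwards [hg a] with y hy
    filter_upwards [ih hy (by omega)] with o ho
    refine Fin.cases ?_ fun i => ?_
    · simpa using sq_le_sq' (abs_le.1 (hg.abs_advGap_le (by omega) π a)).1
        (abs_le.1 (hg.abs_advGap_le (by omega) π a)).2
    · have := ho i
      rw [Fin.cons_succ, Fin.val_succ, show h + (i.val + 1) = h + 1 + i.val by ring]
      exact this

lemma Good.ae_sumSqGap_le (hg : M.Good R n h x s) (hn : h + n = M.H + 1) (π ρ : Policy X A) :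
    ∀ᵐ o ∂(M.rollout ρ n h x), M.sumSqGap π h o ≤ n * R ^ 2 := by
  filter_upwards [hg.ae_advGap_sq_le hn π ρ] with o ho
  exact (Finset.sum_le_sum fun i _ => ho i).trans (by simp)

/-- Optional stopping: the stopped sum of gaps of `π` is centred under `π`. -/
lemma Good.integral_stoppedGap_le (hg : M.Good R n h x s) (hn : h + n = M.H + 1)
    (hz : |z| ≤ B + R) :
    ∫ o, M.stoppedGap π B n h z o ∂(M.rollout π n h x) ≤ z := by
  induction n generalizing h x s z with
  | zero => simp [stoppedGap, stoppedSum]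
  | succ n ih =>
    by_cases hB : B < |z|
    · simp [stoppedGap_of_lt hB]
    have hh : h + n = M.H := by omega
    have hψ := (integrable_const (μ := π.act h x) z).add (hg.integrable_advGap hh π π)
    refine (integral_rollout_succ_le (.of_bound .of_discrete _ (hg.ae_abs_stoppedGap_le hn π π hz))
      (φ := fun a _ => z + M.advGap π h x a) (ψ := fun a => z + M.advGap π h x a)
      (fun a => integrable_const _) hψ (fun a => ?_) (fun a => by simp)).trans ?_
    · filter_upwards [hg a] with y hy
      simp only [stoppedGap_cons hB]
      exact ih hy (by omega) ((abs_add_le _ _).trans (by linarith [hg.abs_advGap_le hh π a]))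
    · rw [integral_add (integrable_const _) (hg.integrable_advGap hh π π), hg.integral_advGap hh]
      simp

/-- The second moment of the stopped sum of gaps is at most the sum of their second moments. -/
lemma Good.integral_stoppedGap_sq_sub_le (hg : M.Good R n h x s) (hn : h + n = M.H + 1)
    (hz : |z| ≤ B + R) :
    ∫ o, (M.stoppedGap π B n h z o ^ 2 - M.sumSqGap π h o) ∂(M.rollout π n h x) ≤ z ^ 2 := by
  induction n generalizing h x s z with
  | zero => simp [stoppedGap, stoppedSum, sumSqGap]
  | succ n ih =>
    have hint : Integrable (fun o => M.stoppedGap π B (n + 1) h z o ^ 2 - M.sumSqGap π h o)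
        (M.rollout π (n + 1) h x) := by
      refine .of_bound .of_discrete ((B + R) ^ 2 + (n + 1 : ℕ) * R ^ 2) ?_
      filter_upwards [hg.ae_abs_stoppedGap_le hn π π hz, hg.ae_sumSqGap_le hn π π] with o h1 h2
      have h3 := sq_le_sq' (abs_le.1 h1).1 (abs_le.1 h1).2
      have h4 := sumSqGap_nonneg (M := M) (π := π) (h := h) o
      have h5 := sq_nonneg (M.stoppedGap π B (n + 1) h z o)
      have h6 := sq_nonneg (B + R)
      rw [Real.norm_eq_abs, abs_le]
      constructor <;> linarith
    by_cases hB : B < |z|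
    · have : ∫ o, (M.stoppedGap π B (n + 1) h z o ^ 2 - M.sumSqGap π h o)
          ∂(M.rollout π (n + 1) h x) ≤ ∫ o, z ^ 2 ∂(M.rollout π (n + 1) h x) := by
        refine integral_mono hint (integrable_const _) fun o => ?_
        simp only [stoppedGap_of_lt hB]
        linarith [sumSqGap_nonneg (M := M) (π := π) (h := h) o]
      simpa using this
    have hh : h + n = M.H := by omega
    -- With `g` the gap, `(z + g)² - g² = z² + 2zg` is affine in `g`, and `g` is centred under `π`.
    have hgi := (hg.integrable_advGap hh π π).const_mul (2 * z)
    refine (integral_rollout_succ_le hint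
      (φ := fun a _ => z ^ 2 + 2 * z * M.advGap π h x a)
      (ψ := fun a => z ^ 2 + 2 * z * M.advGap π h x a)
      (fun a => integrable_const _) ((integrable_const _).add hgi)
      (fun a => ?_) (fun a => by simp)).trans ?_
    · filter_upwards [hg a] with y hy
      have hz' : |z + M.advGap π h x a| ≤ B + R :=
        (abs_add_le _ _).trans (by linarith [hg.abs_advGap_le hh π a])
      have key := ih hy (by omega) hz'
      have hint' : Integrable (fun o => M.stoppedGap π B n (h + 1) (z + M.advGap π h x a) o ^ 2 -
          M.sumSqGap π (h + 1) o) (M.rollout π n (h + 1) y) := by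
        refine .of_bound .of_discrete ((B + R) ^ 2 + n * R ^ 2) ?_
        filter_upwards [hy.ae_abs_stoppedGap_le (by omega) π π hz',
          hy.ae_sumSqGap_le (by omega) π π] with o h1 h2
        have h3 := sq_le_sq' (abs_le.1 h1).1 (abs_le.1 h1).2
        have h4 := sumSqGap_nonneg (M := M) (π := π) (h := h + 1) o
        have h5 := sq_nonneg (M.stoppedGap π B n (h + 1) (z + M.advGap π h x a) o)
        have h6 := sq_nonneg (B + R)
        rw [Real.norm_eq_abs, abs_le]
        constructor <;> linarith
      simp only [stoppedGap_cons hB, sumSqGap_cons, sub_add_eq_sub_sub_swap]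
      rw [integral_sub hint' (integrable_const _)]
      simp only [integral_const, probReal_univ, one_smul]
      nlinarith
    · rw [integral_add (integrable_const _) hgi, integral_const_mul, hg.integral_advGap hh]
      simp

/-- Exponential tail bound for the stopped sum of gaps of `π` under `π`. -/
lemma Good.integral_exp_stopped_le (hR : 0 < R) (hg : M.Good R n h x s) (hn : h + n = M.H + 1) :
    ∫ o, (if B < |M.stoppedGap π B n h z o| then Real.exp (B / R / 3) else 0)
      ∂(M.rollout π n h x) ≤ potential R z (s + M.value π n h x) := by
  induction n generalizing h x s z with
  | zero =>
    have hs := hg.value_mem π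
    rw [rollout_zero_apply, integral_dirac, stoppedGap_zero]
    split_ifs with hz
    · exact exp_le_potential hR hs hz
    · exact potential_nonneg hR hs
  | succ n ih =>
    have hs := hg.value_mem π
    by_cases hB : B < |z|
    · simp only [stoppedGap_of_lt hB, if_pos hB, integral_const, probReal_univ, one_smul]
      exact exp_le_potential hR hs hB
    have hh : h + n = M.H := by omega
    set v := s + M.value π (n + 1) h x with hv
    set c := (Real.exp (z / R / 3) * (2 * (v / R) + (2 - (v / R) ^ 2) / 3) +
        Real.exp (-(z / R / 3)) * (2 * (v / R) - (2 - (v / R) ^ 2) / 3)) / R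
    have hgi := (hg.integrable_advGap hh π π).mul_const c
    have hint : Integrable (fun o => if B < |M.stoppedGap π B (n + 1) h z o|
        then Real.exp (B / R / 3) else 0) (M.rollout π (n + 1) h x) := by
      refine .of_bound .of_discrete (Real.exp (B / R / 3)) (.of_forall fun o => ?_)
      split_ifs <;> simp [Real.exp_nonneg]
    have hbd : ∀ a, ∀ᵐ y ∂(M.trans h (x, a)),
        (s + (M.reward h x a + M.value π n (h + 1) y)) / R ∈ Set.Icc (0 : ℝ) 1 := by
      intro a
      filter_upwards [hg.ae_value_mem π a] with y hy
      exact ⟨div_nonneg hy.1 hR.le, (div_le_one hR).2 hy.2⟩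
    have hi1 : ∀ a, Integrable (fun y => (s + (M.reward h x a + M.value π n (h + 1) y)) / R)
        (M.trans h (x, a)) := fun a => by
      refine .of_bound .of_discrete 1 ((hbd a).mono fun y hy => ?_)
      rw [Real.norm_of_nonneg hy.1]; exact hy.2
    have hi2 : ∀ a, Integrable (fun y => ((s + (M.reward h x a + M.value π n (h + 1) y)) / R) ^ 2)
        (M.trans h (x, a)) := fun a => by
      refine .of_bound .of_discrete 1 ((hbd a).mono fun y hy => ?_)
      rw [Real.norm_of_nonneg (sq_nonneg _)]
      exact pow_le_one₀ hy.1 hy.2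
    refine (integral_rollout_succ_le hint
      (φ := fun a y => potential R (z + M.advGap π h x a)
        (s + (M.reward h x a + M.value π n (h + 1) y)))
      (ψ := fun a => potential R z v + M.advGap π h x a * c)
      (fun a => ((integrable_const _).sub (hi2 a)).const_mul _) ((integrable_const _).add hgi)
      (fun a => ?_) (fun a => ?_)).trans ?_
    · filter_upwards [hg a] with y hy
      simp only [stoppedGap_cons hB]
      rw [← add_assoc]
      exact ih hy (by omega)
    · have hQ : s + M.Q π h x a = ∫ y, (s + (M.reward h x a + M.value π n (h + 1) y))
          ∂(M.trans h (x, a)) := by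
        rw [integral_add (integrable_const _)
          (hg.integrable_reward_add_value π a), hg.Q_eq_integral_value hh]
        simp
      have hgap : M.advGap π h x a = v - (s + M.Q π h x a) := by rw [hg.advGap_eq hh]; ring
      have hstep := potential_add_le (z := z) hR hs (hg.Q_mem hh π a)
      rw [← hgap] at hstep
      refine le_trans ?_ hstep
      simp only [potential]
      rw [integral_const_mul, integral_sub (integrable_const _) (hi2 a)]
      refine mul_le_mul_of_nonneg_left ?_ (by positivity)
      simp only [integral_const, probReal_univ, one_smul]
      rw [hQ, ← integral_div]
      -- Jensen: the mean of the squared next value is at least `(s + Q)²`. The square enters the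
      -- potential with a negative sign, so averaging over the next state can only lower it.
      have := ConvexOn.map_integral_le (μ := M.trans h (x, a)) (even_two.convexOn_pow (𝕜 := ℝ))
        (continuous_pow 2).continuousOn isClosed_univ (.of_forall fun _ => Set.mem_univ _)
        (hi1 a) (hi2 a)
      linarith
    · rw [integral_add (integrable_const _) hgi, integral_mul_const, hg.integral_advGap hh]
      simp

/-- Performance difference with stopping, in terms of the rewards collected by `ρ`. -/
lemma Good.value_le_integral_stoppedGap (hR : 0 ≤ R) (hg : M.Good R n h x s)
    (hn : h + n = M.H + 1) (hz : |z| ≤ B + R) :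
    ∫ o, -(M.stoppedGap π B n h z o + M.cumReward h o +
      if B < |M.stoppedGap π B n h z o| then R else 0) ∂(M.rollout ρ n h x) ≤
      -(z + M.value π n h x) := by
  induction n generalizing h x s z with
  | zero =>
    rw [rollout_zero_apply, integral_dirac, stoppedGap_zero]
    simp only [value_zero, cumReward, Finset.univ_eq_empty, Finset.sum_empty]
    split_ifs <;> linarith
  | succ n ih =>
    have hint : Integrable (fun o => -(M.stoppedGap π B (n + 1) h z o + M.cumReward h o +
        if B < |M.stoppedGap π B (n + 1) h z o| then R else 0)) (M.rollout ρ (n + 1) h x) := by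
      refine Integrable.neg (Integrable.add (Integrable.add ?_ (hg.integrable_cumReward ρ)) ?_)
      · exact .of_bound .of_discrete _ (hg.ae_abs_stoppedGap_le hn π ρ hz)
      · refine .of_bound .of_discrete R (.of_forall fun o => ?_)
        split_ifs <;> simp [abs_of_nonneg, hR]
    have hv := hg.value_mem π
    by_cases hB : B < |z|
    -- Once stopped, the value is at most `R - s` and the rewards still to come are at least `-s`,
    -- so the extra `R` covers their difference.
    · refine (integral_mono_ae hint (integrable_const (-(z + M.value π (n + 1) h x))) ?_).trans
        (by simp)
      filter_upwards [hg.ae ρ] with o ho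
      simp only [stoppedGap_of_lt hB, if_pos hB]
      linarith [hv.2, ho.1]
    have hh : h + n = M.H := by omega
    -- For each action separately, gap plus `Q` is the current value, so the law from which `ρ`
    -- draws actions plays no role. The claim is negated throughout because the one-step lemma
    -- yields upper bounds.
    refine (integral_rollout_succ_le hint
      (φ := fun a y => -(z + M.advGap π h x a + (M.reward h x a + M.value π n (h + 1) y)))
      (ψ := fun a => -(z + M.value π (n + 1) h x))
      (fun a => ?_) (integrable_const _) (fun a => ?_) (fun a => ?_)).trans (by simp)
    · exact ((integrable_const _).add ((integrable_const _).add (hg.integrable_value π a))).neg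
    · filter_upwards [hg a] with y hy
      have hz' : |z + M.advGap π h x a| ≤ B + R :=
        (abs_add_le _ _).trans (by linarith [hg.abs_advGap_le hh π a])
      have hint' : Integrable (fun o => -(M.stoppedGap π B n (h + 1) (z + M.advGap π h x a) o +
          M.cumReward (h + 1) o +
          if B < |M.stoppedGap π B n (h + 1) (z + M.advGap π h x a) o| then R else 0))
          (M.rollout ρ n (h + 1) y) := by
        refine Integrable.neg (Integrable.add (Integrable.add ?_ (hy.integrable_cumReward ρ)) ?_)
        · exact .of_bound .of_discrete _ (hy.ae_abs_stoppedGap_le (by omega) π ρ hz')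
        · refine .of_bound .of_discrete R (.of_forall fun o => ?_)
          split_ifs <;> simp [abs_of_nonneg, hR]
      have key := ih hy (by omega) hz'
      have e : ∀ o : Fin n → X × A,
          -(M.stoppedGap π B (n + 1) h z (Fin.cons (x, a) o) +
            M.cumReward h (Fin.cons (x, a) o : Fin (n + 1) → X × A) +
            if B < |M.stoppedGap π B (n + 1) h z (Fin.cons (x, a) o)| then R else 0) =
          -(M.stoppedGap π B n (h + 1) (z + M.advGap π h x a) o + M.cumReward (h + 1) o +
          if B < |M.stoppedGap π B n (h + 1) (z + M.advGap π h x a) o| then R else 0) -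
          M.reward h x a := fun o => by
        rw [stoppedGap_cons hB, cumReward_cons]; ring
      simp only [e]
      rw [integral_sub hint' (integrable_const _)]
      simp only [integral_const, probReal_univ, one_smul]
      linarith
    · rw [integral_neg, integral_add (integrable_const _)
        (hg.integrable_reward_add_value π a), ← hg.Q_eq_integral_value hh,
        hg.advGap_eq hh]
      simp only [integral_const, probReal_univ, one_smul]
      linarith

end MDP

/-! ### Means over whole episodes -/

namespace MDP

variable {X A : Type*} [MeasurableSpace X] [MeasurableSpace A] {M : MDP X A} {R B : ℝ}

lemma integral_stopped (π ρ : Policy X A) (c : ℝ) :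
    ∫ o, (if B < |M.stoppedGap π B M.H 1 0 o| then c else 0) ∂(M.law ρ) =
      c * ∫ o, (if B < |M.stoppedGap π B M.H 1 0 o| then 1 else 0) ∂(M.law ρ) := by
  rw [← integral_const_mul]
  simp

variable [Countable X] [DiscreteMeasurableSpace X] [Countable A] [DiscreteMeasurableSpace A]

lemma RewardNormalized.ae_abs_stoppedGap_le (hM : M.RewardNormalized R) (hBR : 0 ≤ B + R)
    (π ρ : Policy X A) : ∀ᵐ o ∂(M.law ρ), |M.stoppedGap π B M.H 1 0 o| ≤ B + R := by
  rw [ae_law]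
  filter_upwards [hM.good π] with x hx
  exact hx.ae_abs_stoppedGap_le (by omega) π ρ (by simpa using hBR)

lemma RewardNormalized.integrable_stoppedGap (hM : M.RewardNormalized R) (hBR : 0 ≤ B + R)
    (π ρ : Policy X A) : Integrable (fun o => M.stoppedGap π B M.H 1 0 o) (M.law ρ) :=
  .of_bound .of_discrete _ (hM.ae_abs_stoppedGap_le hBR π ρ)

lemma RewardNormalized.integrable_stoppedGap_sq (hM : M.RewardNormalized R) (hBR : 0 ≤ B + R)
    (π ρ : Policy X A) : Integrable (fun o => M.stoppedGap π B M.H 1 0 o ^ 2) (M.law ρ) := by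
  refine .of_bound .of_discrete ((B + R) ^ 2) ?_
  filter_upwards [hM.ae_abs_stoppedGap_le hBR π ρ] with o ho
  rw [norm_pow]
  exact pow_le_pow_left₀ (norm_nonneg _) ho 2

lemma RewardNormalized.integrable_cumReward (hM : M.RewardNormalized R) (ρ : Policy X A) :
    Integrable (fun o => M.cumReward 1 o) (M.law ρ) := by
  refine .of_bound .of_discrete R ((hM ρ).mono fun o ho => ?_)
  rw [Real.norm_of_nonneg ho.1]
  exact ho.2

lemma RewardNormalized.integral_stoppedGap_nonpos (hM : M.RewardNormalized R) (hBR : 0 ≤ B + R)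
    (π : Policy X A) : ∫ o, M.stoppedGap π B M.H 1 0 o ∂(M.law π) ≤ 0 := by
  refine (M.integral_law_le π (hM.integrable_stoppedGap hBR π π) (integrable_const (0 : ℝ))
    ?_).trans (by simp)
  filter_upwards [hM.good π] with x hx
  exact hx.integral_stoppedGap_le (by omega) (by simpa using hBR)

lemma RewardNormalized.ae_advGap_sq_le (hM : M.RewardNormalized R) (π ρ : Policy X A) :
    ∀ᵐ o ∂(M.law ρ), ∀ i : Fin M.H, M.advGap π (1 + i) (o i).1 (o i).2 ^ 2 ≤ R ^ 2 := by
  rw [ae_law]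
  filter_upwards [hM.good π] with x hx
  exact hx.ae_advGap_sq_le (by omega) π ρ

lemma RewardNormalized.integral_stoppedGap_sq_le (hM : M.RewardNormalized R) (hBR : 0 ≤ B + R)
    (π : Policy X A) : ∫ o, M.stoppedGap π B M.H 1 0 o ^ 2 ∂(M.law π) ≤ M.sigmaSq π := by
  have hi : ∀ i : Fin M.H, Integrable (fun o : Fin M.H → X × A =>
      M.advGap π (1 + i) (o i).1 (o i).2 ^ 2) (M.law π) := fun i => by
    refine .of_bound .of_discrete (R ^ 2) ((hM.ae_advGap_sq_le π π).mono fun o ho => ?_)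
    rw [Real.norm_of_nonneg (sq_nonneg _)]
    exact ho i
  have hs : Integrable (fun o => M.sumSqGap π 1 o) (M.law π) :=
    integrable_finsetSum _ fun i _ => hi i
  have hσ : M.sigmaSq π = ∫ o, M.sumSqGap π 1 o ∂(M.law π) := by
    simp only [sumSqGap]
    rw [integral_finsetSum _ fun i _ => hi i, sigmaSq]
    simp only [add_comm]
  have hz := hM.integrable_stoppedGap_sq hBR π π
  have key : ∫ o, (M.stoppedGap π B M.H 1 0 o ^ 2 - M.sumSqGap π 1 o) ∂(M.law π) ≤ 0 := by
    refine (M.integral_law_le π (hz.sub hs) (integrable_const (0 : ℝ)) ?_).trans (by simp)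
    filter_upwards [hM.good π] with x hx
    simpa using hx.integral_stoppedGap_sq_sub_le (π := π) (by omega) (z := 0) (by simpa using hBR)
  rw [integral_sub hz hs] at key
  linarith

lemma integrable_stopped (π ρ : Policy X A) (c : ℝ) :
    Integrable (fun o => if B < |M.stoppedGap π B M.H 1 0 o| then c else 0) (M.law ρ) := by
  refine .of_bound .of_discrete |c| (.of_forall fun o => ?_)
  split_ifs <;> simp

lemma RewardNormalized.exp_mul_integral_stopped_le (hM : M.RewardNormalized R) (hR : 0 < R)
    (π : Policy X A) : Real.exp (B / R / 3) *
      ∫ o, (if B < |M.stoppedGap π B M.H 1 0 o| then 1 else 0) ∂(M.law π) ≤ 4 := by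
  rw [← integral_stopped]
  refine (M.integral_law_le π (integrable_stopped π π _) (integrable_const (4 : ℝ)) ?_).trans
    (by simp)
  filter_upwards [hM.good π] with x hx
  refine (hx.integral_exp_stopped_le (z := 0) hR (by omega)).trans (potential_le.trans ?_)
  norm_num

lemma RewardNormalized.J_sub_J_le (hM : M.RewardNormalized R) (hR : 0 ≤ R) (hBR : 0 ≤ B + R)
    (π ρ : Policy X A) :
    M.J π - M.J ρ ≤ ∫ o, M.stoppedGap π B M.H 1 0 o ∂(M.law ρ) +
      R * ∫ o, (if B < |M.stoppedGap π B M.H 1 0 o| then 1 else 0) ∂(M.law ρ) := by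
  have hz := hM.integrable_stoppedGap hBR π ρ
  have hc := hM.integrable_cumReward ρ
  have hs := integrable_stopped (M := M) (B := B) π ρ R
  have hzc : Integrable (fun o => M.stoppedGap π B M.H 1 0 o + M.cumReward 1 o) (M.law ρ) :=
    hz.add hc
  have hv : Integrable (fun x => M.value π M.H 1 x) M.init := by
    refine .of_bound .of_discrete R ((hM.good π).mono fun x hx => ?_)
    have := hx.value_mem π
    rw [zero_add] at this
    rw [Real.norm_of_nonneg this.1]
    exact this.2
  have hJ : M.J π = ∫ x, M.value π M.H 1 x ∂M.init := integral_law M π (hM.integrable_cumReward π)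
  have key := M.integral_law_le ρ (hzc.add hs).neg hv.neg (by
    filter_upwards [hM.good π] with x hx
    simpa using hx.value_le_integral_stoppedGap (π := π) (ρ := ρ) (B := B) (z := 0) hR (by omega)
      (by simpa using hBR))
  simp only [Pi.neg_apply, Pi.add_apply] at key
  rw [integral_neg, integral_neg, integral_add hzc hs, integral_add hz hc, integral_stopped] at key
  rw [hJ, J]
  linarith

end MDP

/-! ### Choice of the level and final assembly -/

theorem theorem3p1 :
    ∃ C : ℝ, 0 < C ∧
      ∀ (X A : Type*) [Countable X] [MeasurableSpace X] [DiscreteMeasurableSpace X]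
        [Countable A] [MeasurableSpace A] [DiscreteMeasurableSpace A]
        (M : MDP X A) (R : ℝ), 1 ≤ R → M.RewardNormalized R →
        ∀ (πstar πhat : Policy X A) (ε : ℝ), 0 < ε → ε < Real.exp (-1) →
          M.J πstar - M.J πhat ≤
            √(6 * M.sigmaSq πstar * hellingerSq (M.law πhat) (M.law πstar))
              + C * (R * Real.log (R / ε)) * hellingerSq (M.law πhat) (M.law πstar) + ε := by
  -- 28 = 24 + 2 + 2: the term `2 * (B + R) * D` gives 24 and 2, the stopping probability under `π̂`
  -- gives 2, using `R ≤ R * log (R / ε)`.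
  refine ⟨28, by norm_num, ?_⟩
  intro X A _ _ _ _ _ _ M R hR hM πstar πhat ε hε hε1
  have hR0 : 0 < R := by linarith
  set t := R / ε with ht
  have htexp : Real.exp 1 ≤ t := by
    rw [ht, le_div_iff₀ hε]
    have := mul_lt_mul_of_pos_left hε1 (Real.exp_pos 1)
    rw [← Real.exp_add] at this
    norm_num at this
    linarith
  have ht0 : 0 < t := by positivity
  have ht2 : 2 ≤ t := by linarith [Real.add_one_le_exp (1 : ℝ)]
  have hlog : 1 ≤ Real.log t := (Real.le_log_iff_exp_le ht0).2 htexp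
  -- At rate `1 / (3R)` this level gives `exp (B / (3R)) = t ^ 4`, so the stopping probability `p`
  -- under `π⋆` is at most `4 / t ^ 4`, and `2 * R * p = 2 * ε * t * p ≤ 8 * ε / t ^ 3 ≤ ε` as `t ≥
  -- 2`.
  set B := 12 * R * Real.log t with hB
  have hRl : R ≤ R * Real.log t := le_mul_of_one_le_right hR0.le hlog
  have hBR : 0 ≤ B + R := by nlinarith
  set D := hellingerSq (M.law πhat) (M.law πstar) with hD
  have hD0 : 0 ≤ D := hellingerSq_nonneg _ _
  set Z : (Fin M.H → X × A) → ℝ := fun o => M.stoppedGap πstar B M.H 1 0 o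
  have hZ : ∀ ρ, ∀ᵐ o ∂(M.law ρ), |Z o| ≤ B + R := hM.ae_abs_stoppedGap_le hBR πstar
  have hdiff := hM.J_sub_J_le hR0.le hBR πstar πhat
  have hmean := hM.integral_stoppedGap_nonpos hBR πstar
  have hvar := hM.integral_stoppedGap_sq_le hBR πstar
  have htail := hM.exp_mul_integral_stopped_le (B := B) hR0 πstar
  have hchange := integral_sub_le_sqrt_hellingerSq (f := Z) .of_discrete (hZ πhat) (hZ πstar)
  have hZ2 : ∀ ρ, ∀ᵐ o ∂(M.law ρ), 0 ≤ Z o ^ 2 ∧ Z o ^ 2 ≤ (B + R) ^ 2 := fun ρ =>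
    (hZ ρ).mono fun o ho => ⟨sq_nonneg _, sq_le_sq' (abs_le.1 ho).1 (abs_le.1 ho).2⟩
  have hsq := integral_le_two_mul_add_hellingerSq .of_discrete (hZ2 πhat) (hZ2 πstar)
  have hP : ∀ ρ, ∀ᵐ o ∂(M.law ρ), (0 : ℝ) ≤ (if B < |Z o| then 1 else 0) ∧
      (if B < |Z o| then (1 : ℝ) else 0) ≤ 1 := fun ρ => .of_forall fun o => by
    split_ifs <;> norm_num
  have hprob := integral_le_two_mul_add_hellingerSq .of_discrete (hP πhat) (hP πstar)
  set p := ∫ o, (if B < |Z o| then (1 : ℝ) else 0) ∂(M.law πstar)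
  have hp0 : 0 ≤ p := integral_nonneg_of_ae ((hP πstar).mono fun o ho => ho.1)
  have hp : 2 * R * p ≤ ε := by
    have he : Real.exp (B / R / 3) = t ^ 4 := by
      rw [hB, show 12 * R * Real.log t / R / 3 = (4 : ℕ) * Real.log t by
        field_simp; norm_num, Real.exp_nat_mul, Real.exp_log ht0]
    rw [he] at htail
    have h8 : (8 : ℝ) ≤ t ^ 3 := by
      have := pow_le_pow_left₀ (by norm_num : (0 : ℝ) ≤ 2) ht2 3
      linarith
    have htp : 0 ≤ t * p := by positivity
    have h1 : 8 * (t * p) ≤ 4 := by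
      calc 8 * (t * p) ≤ t ^ 3 * (t * p) := mul_le_mul_of_nonneg_right h8 htp
        _ = t ^ 4 * p := by ring
        _ ≤ 4 := htail
    have h2 : R = ε * t := by rw [ht]; field_simp
    calc 2 * R * p = ε * (2 * (t * p)) := by rw [h2]; ring
      _ ≤ ε * 1 := by gcongr; linarith
      _ = ε := mul_one _
  have hσ0 : 0 ≤ M.sigmaSq πstar :=
    Finset.sum_nonneg fun i _ => integral_nonneg fun _ => sq_nonneg _
  -- The radicand is at most `6σ²D + (2(B + R)D)²`, and `√(a² + b²) ≤ a + b` for `a, b ≥ 0`.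
  have hroot : √(2 * D * (∫ o, Z o ^ 2 ∂(M.law πhat) + ∫ o, Z o ^ 2 ∂(M.law πstar))) ≤
      √(6 * M.sigmaSq πstar * D) + 2 * (B + R) * D := by
    refine Real.sqrt_le_iff.2 ⟨by positivity, ?_⟩
    have h1 := Real.sq_sqrt (by positivity : 0 ≤ 6 * M.sigmaSq πstar * D)
    have h2 : 0 ≤ √(6 * M.sigmaSq πstar * D) * (2 * (B + R) * D) := by positivity
    have h3 : ∫ o, Z o ^ 2 ∂(M.law πhat) + ∫ o, Z o ^ 2 ∂(M.law πstar) ≤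
        3 * M.sigmaSq πstar + 2 * (B + R) ^ 2 * D := by linarith
    have h4 := mul_le_mul_of_nonneg_left h3 (by positivity : 0 ≤ 2 * D)
    nlinarith
  have hprobR := mul_le_mul_of_nonneg_left hprob hR0.le
  have hRD := mul_le_mul_of_nonneg_right hRl hD0
  have hBD : B * D = 12 * (R * Real.log t * D) := by rw [hB]; ring
  have hmain : M.J πstar - M.J πhat ≤ √(6 * M.sigmaSq πstar * D) + 2 * (B + R) * D +
      (2 * R * p + 2 * (R * D)) := by linarith
  nlinarith
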